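/- Let $\mathbf k$ be a commutative ring with unit, $\lambda\in\mathbf k$, $X$ a set and $\Omega$ a semigroup. Algebras are unitary associative $\mathbf k$-algebras, not necessarily commutative. A Rota–Baxter family algebra of weight $\lambda$ is a $\mathbf k$-algebra $R$ with $\mathbf k$-linear operators $(P_\omega)_{\omega\in\Omega}$ on $R$ such that, for all $a,b\in R$ and $\alpha,\beta\in\Omega$, $$P_\alpha(a)P_\beta(b)=P_{\alpha\beta}\big(P_\alpha(a)\,b+a\,P_\beta(b)+\lambda ab\big).$$ A morphism of such algebras is a unital $\mathbf k$-algebra morphism that commutes with the operators of each index $\omega\in\Omega$. Let $\mathcal T=\mathcal T(X,\Omega)$ be the set of (finite) $X$-angularly decorated $\Omega$-typed planar rooted trees. These are defined inductively: a tree $T\in\mathcal T$ consists of a root vertex with $n+1\ge 1$ incoming edges $e_1,\dots,e_{n+1}$, ordered from left to right, and elements $x_1,\dots,x_n\in X$ that decorate the $n$ angles between adjacent edges; each $e_i$ is either a leaf, carrying no decoration, or an internal edge, carrying a type $\alpha_i\in\Omega$ and a tree $T_i\in\mathcal T$ grafted on it. Write $T=[e_1,x_1,e_2,\dots,x_n,e_{n+1}]$,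 and write $|$ for a leaf and $(\alpha,U)$ for an internal edge of type $\alpha$ with the tree $U$ grafted on it. Let $\mathbf k\mathcal T$ be the free $\mathbf k$-module on $\mathcal T$. For $\omega\in\Omega$ let $B^+_\omega:\mathbf k\mathcal T\to\mathbf k\mathcal T$ be the linear map with $B^+_\omega(T)=[(\omega,T)]$ for $T\in\mathcal T$. Let $\diamond$ be the bilinear product on $\mathbf k\mathcal T$ defined on trees $T=[e_1,x_1,\dots,x_m,e_{m+1}]$ and $T'=[e'_1,y_1,\dots,y_n,e'_{n+1}]$ by induction on the sum of their depths, as follows. * If $e_{m+1}=|$, then $T\diamond T'=[e_1,x_1,\dots,x_m,e'_1,y_1,e'_2,\dots,y_n,e'_{n+1}]$. * If $e'_1=|$, then $T\diamond T'=[e_1,x_1,\dots,x_m,e_{m+1},y_1,e'_2,\dots,y_n,e'_{n+1}]$. * If $e_{m+1}=(\alpha,U)$ and $e'_1=(\beta,U')$, then $$T\diamond T'=\Big([e_1,x_1,\dots,x_m,|]\diamond B^+_{\alpha\beta}\big(B^+_\alpha(U)\diamond U'+U\diamond B^+_\beta(U')+\lambda\, U\diamond U'\big)\Big)\diamond[\,|,y_1,e'_2,\dots,y_n,e'_{n+1}].$$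 (The first two rules agree when both apply.) Let $j_X:X\to\mathbf k\mathcal T$, $j_X(x)=[\,|,x,|\,]$. **Theorem.** $(\mathbf k\mathcal T,\diamond,(B^+_\omega)_{\omega\in\Omega})$, together with $j_X$, is the free Rota–Baxter family algebra of weight $\lambda$ on $X$. That is: $(\mathbf k\mathcal T,\diamond)$ is an associative algebra with unit the one-leaf, one-vertex tree $[\,|\,]$, and $(B^+_\omega)_{\omega\in\Omega}$ is a Rota–Baxter family of weight $\lambda$ on it; and for every Rota–Baxter family algebra $(A,(P_\omega)_{\omega\in\Omega})$ of weight $\lambda$ and every map $f:X\to A$ there is a unique morphism of Rota–Baxter family algebras $\bar f:\mathbf k\mathcal T\to A$ with $\bar f\circ j_X=f$. -/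

import Mathlib

universe u v w z

/-- An incoming edge of a vertex of an `Ω`-typed planar rooted tree, together with what is grafted
on it: either a leaf (no vertex above it, no type), or an internal edge with a type `ω : Ω` that
leads to the root vertex of a tree of the type `T`. -/
inductive Branch (Ω : Type v) (T : Type w) : Type (max v w)
  | leaf : Branch Ω T
  | edge (ω : Ω) (t : T) : Branch Ω T

/-- `X`-angularly decorated `Ω`-typed planar rooted trees, with at least one vertex. A tree is
given by the incoming edges `e₁, …, eₙ₊₁` of its root vertex, listed from left to right, `n ≥ 0`,
and the decorations `x₁, …, xₙ` of the `n` angles between adjacent edges: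
`cons e₁ x₁ (cons e₂ x₂ (… (single eₙ₊₁)))`. -/
inductive PlanarTree (X : Type u) (Ω : Type v) : Type (max u v)
  | single (e : Branch Ω (PlanarTree X Ω)) : PlanarTree X Ω
  | cons (e : Branch Ω (PlanarTree X Ω)) (x : X) (rest : PlanarTree X Ω) : PlanarTree X Ω

namespace PlanarTree

variable {X : Type u} {Ω : Type v}

/-- The tree with one vertex and one leaf. -/
def unit : PlanarTree X Ω := single .leaf

/-- The tree with one vertex, two leaves and one angle, decorated by `x`. -/
def corolla (x : X) : PlanarTree X Ω := cons .leaf x (single .leaf)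

/-- Grafting on a new root vertex, through a new internal edge of type `ω`. -/
def graft (ω : Ω) (T : PlanarTree X Ω) : PlanarTree X Ω := single (.edge ω T)

/-- The maximal number of vertices on a path from the root to a leaf. -/
def depth : PlanarTree X Ω → ℕ
  | single .leaf => 1
  | single (.edge _ T) => T.depth + 1
  | cons .leaf _ R => R.depth
  | cons (.edge _ T) _ R => max (T.depth + 1) R.depth

/-- The leftmost incoming edge of the root vertex. -/
def first : PlanarTree X Ω → Branch Ω (PlanarTree X Ω)
  | single e => e
  | cons e _ _ => e

/-- The rightmost incoming edge of the root vertex. -/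
def last : PlanarTree X Ω → Branch Ω (PlanarTree X Ω)
  | single e => e
  | cons _ _ R => R.last

/-- Replace the leftmost incoming edge of the root vertex by `e`. -/
def setFirst (e : Branch Ω (PlanarTree X Ω)) : PlanarTree X Ω → PlanarTree X Ω
  | single _ => single e
  | cons _ x R => cons e x R

/-- For `S` with root edges `a₁, …, aₘ₊₁` and angles `x₁, …, xₘ`, and `T` with root edges
`b₁, …, bₙ₊₁` and angles `y₁, …, yₙ`, this is the tree with root edges
`a₁, …, aₘ, e, b₂, …, bₙ₊₁` and angles `x₁, …, xₘ, y₁, …, yₙ`: the two root vertices are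
identified, and `aₘ₊₁` and `b₁` are replaced by the single edge `e`. -/
def splice (e : Branch Ω (PlanarTree X Ω)) : PlanarTree X Ω → PlanarTree X Ω → PlanarTree X Ω
  | single _, T => T.setFirst e
  | cons a x R, T => cons a x (splice e R T)

theorem one_le_depth : ∀ T : PlanarTree X Ω, 1 ≤ T.depth
  | single .leaf => by simp [depth]
  | single (.edge _ T) => by simp [depth]
  | cons .leaf _ R => by simpa [depth] using one_le_depth R
  | cons (.edge _ T) _ R => by simp [depth]

theorem depth_lt_of_first {ω : Ω} {S : PlanarTree X Ω} :
    ∀ {T : PlanarTree X Ω}, T.first = .edge ω S → S.depth < T.depth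
  | single e, h => by
    obtain rfl : e = .edge ω S := h
    simp [depth]
  | cons e x R, h => by
    obtain rfl : e = .edge ω S := h
    simp [depth]

theorem depth_lt_of_last {ω : Ω} {S : PlanarTree X Ω} :
    ∀ {T : PlanarTree X Ω}, T.last = .edge ω S → S.depth < T.depth
  | single e, h => by
    obtain rfl : e = .edge ω S := h
    simp [depth]
  | cons .leaf x R, h => by
    have := depth_lt_of_last (T := R) h
    simpa [depth] using this
  | cons (.edge _ T) x R, h => by
    have := depth_lt_of_last (T := R) h
    simp [depth, this]

/-- The product `S ⋄ T` of weight `lam` of two trees, an element of the free module on trees.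

If the last root edge of `S` or the first root edge of `T` is a leaf, then the root vertices are
identified and the leaf is absorbed by the other edge. If these two edges are `edge α S'` and
`edge β T'`, then they are replaced by the terms of
`B⁺_α(S') ⋄ B⁺_β(T') = B⁺_{αβ}(B⁺_α(S') ⋄ T' + S' ⋄ B⁺_β(T') + lam • (S' ⋄ T'))`:
for a single tree `U`, `splice (edge (α * β) U) S T` is the tree `(S° ⋄ B⁺_{αβ}(U)) ⋄ °T`, where
`S°` is `S` with its last root edge replaced by a leaf, and `°T` is `T` with its first root edge
replaced by a leaf. -/
noncomputable def mul [Semigroup Ω] {k : Type w} [CommRing k] (lam : k)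
    (S T : PlanarTree X Ω) : PlanarTree X Ω →₀ k :=
  match hS : S.last, hT : T.first with
  | .leaf, e => Finsupp.single (splice e S T) 1
  | .edge α S', .leaf => Finsupp.single (splice (.edge α S') S T) 1
  | .edge α S', .edge β T' =>
    Finsupp.mapDomain (fun U => splice (.edge (α * β) U) S T)
      (mul lam (graft α S') T' + mul lam S' (graft β T') + lam • mul lam S' T')
termination_by S.depth + T.depth
decreasing_by
  all_goals
    have h1 := depth_lt_of_last hS
    have h2 := depth_lt_of_first hT
    try simp only [graft, depth]
    omega

/-- The product `⋄` of weight `lam` on the free `k`-module on trees, by bilinear extension. -/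
noncomputable def diamond [Semigroup Ω] {k : Type w} [CommRing k] (lam : k) :
    (PlanarTree X Ω →₀ k) →ₗ[k] (PlanarTree X Ω →₀ k) →ₗ[k] (PlanarTree X Ω →₀ k) :=
  Finsupp.lift _ k _ fun S => Finsupp.lift _ k _ fun T => mul lam S T

/-- The grafting operator `B⁺_ω`, by linear extension. -/
noncomputable def graftL (k : Type w) [CommRing k] (ω : Ω) :
    (PlanarTree X Ω →₀ k) →ₗ[k] (PlanarTree X Ω →₀ k) :=
  Finsupp.lmapDomain k k (graft ω)

end PlanarTree

/-- `(R, mul, one, P)` is a Rota-Baxter family algebra of weight `lam` over `k`, indexed by `Ω`: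
the bilinear product `mul` makes the `k`-module `R` a unital associative `k`-algebra with unit
`one`, and `P` is a Rota-Baxter family of weight `lam` on it. -/
structure IsRotaBaxterFamilyAlgebra {k : Type w} [CommRing k] {Ω : Type v} [Semigroup Ω] (lam : k)
    {R : Type z} [AddCommGroup R] [Module k R] (mul : R →ₗ[k] R →ₗ[k] R) (one : R)
    (P : Ω → R →ₗ[k] R) : Prop where
  mul_assoc : ∀ a b c : R, mul (mul a b) c = mul a (mul b c)
  one_mul : ∀ a : R, mul one a = a
  mul_one : ∀ a : R, mul a one = a
  rota_baxter : ∀ (α β : Ω) (a b : R),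
    mul (P α a) (P β b) = P (α * β) (mul (P α a) b + mul a (P β b) + lam • mul a b)

/-!
Write `S ⋈ₓ T` for the tree obtained by putting the root edges of `S` and `T` side by side, with `x`
in the new angle. Every tree is obtained from the one-leaf tree by graftings and by the operations
`⋈ₓ`, and `⋄` is determined by its unit, the Rota-Baxter identity for two grafted trees, and the
rules `(a ⋈ₓ b) ⋄ c = a ⋈ₓ (b ⋄ c)` and `a ⋄ (b ⋈ₓ c) = (a ⋄ b) ⋈ₓ c`. Hence associativity and
multiplicativity of the evaluation morphism need only be checked on grafted trees, where the
Rota-Baxter identity reduces them to smaller trees. Uniqueness of the morphism follows from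
`a ⋈ₓ b = a ⋄ j(x) ⋄ b`.
-/

section General

variable {k : Type*} [CommSemiring k]

section BasisReduction

variable {σ τ υ M N N' : Type*} [AddCommMonoid M] [Module k M] [AddCommMonoid N] [Module k N]
  [AddCommMonoid N'] [Module k N']

theorem bilin_eq_of_single {m m' : (σ →₀ k) →ₗ[k] (τ →₀ k) →ₗ[k] M}
    (h : ∀ s t, m (Finsupp.single s 1) (Finsupp.single t 1) =
      m' (Finsupp.single s 1) (Finsupp.single t 1))
    (a : σ →₀ k) (b : τ →₀ k) : m a b = m' a b :=
  LinearMap.congr_fun₂ (LinearMap.ext_basis Finsupp.basisSingleOne Finsupp.basisSingleOne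
    fun s t => by simpa only [Finsupp.coe_basisSingleOne] using h s t) a b

theorem bilin_assoc_of_single
    {m₁ : N →ₗ[k] (υ →₀ k) →ₗ[k] M} {m₂ : (σ →₀ k) →ₗ[k] (τ →₀ k) →ₗ[k] N}
    {m₃ : (σ →₀ k) →ₗ[k] N' →ₗ[k] M} {m₄ : (τ →₀ k) →ₗ[k] (υ →₀ k) →ₗ[k] N'}
    (h : ∀ s t u, m₁ (m₂ (Finsupp.single s 1) (Finsupp.single t 1)) (Finsupp.single u 1) =
      m₃ (Finsupp.single s 1) (m₄ (Finsupp.single t 1) (Finsupp.single u 1)))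
    (a : σ →₀ k) (b : τ →₀ k) (c : υ →₀ k) : m₁ (m₂ a b) c = m₃ a (m₄ b c) := by
  have hmaps : m₂.compr₂ m₁ = (LinearMap.llcomp k (υ →₀ k) N' M ∘ₗ m₃).compl₂ m₄ :=
    LinearMap.ext_basis Finsupp.basisSingleOne Finsupp.basisSingleOne fun s t =>
      Finsupp.basisSingleOne.ext fun u => by simpa using h s t u
  exact LinearMap.congr_fun (LinearMap.congr_fun₂ hmaps a b) c

end BasisReduction

theorem assoc_of_rotaBaxter {Ω M : Type*} [Semigroup Ω] [AddCommMonoid M] [Module k M] {lam : k}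
    {m : M →ₗ[k] M →ₗ[k] M} {P : Ω → M →ₗ[k] M}
    (hP : ∀ α β a b, m (P α a) (P β b) = P (α * β) (m (P α a) b + m a (P β b) + lam • m a b))
    {α β γ : Ω} {a b c : M}
    (hab : m (m (P α a) (P β b)) c = m (P α a) (m (P β b) c))
    (hac : m (m (P α a) b) (P γ c) = m (P α a) (m b (P γ c)))
    (hbc : m (m a (P β b)) (P γ c) = m a (m (P β b) (P γ c)))
    (ha : m (m (P α a) b) c = m (P α a) (m b c))
    (hb : m (m a (P β b)) c = m a (m (P β b) c))
    (hc : m (m a b) (P γ c) = m a (m b (P γ c)))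
    (habc : m (m a b) c = m a (m b c)) :
    m (m (P α a) (P β b)) (P γ c) = m (P α a) (m (P β b) (P γ c)) := by
  -- The identity is applied to both outer products, and only then undone on the inner ones,
  -- so that what remains inside `P (α * β * γ)` involves only the simpler triples.
  conv_lhs => rw [hP α β a b, hP, ← hP α β a b]
  conv_rhs => rw [hP β γ b c, hP, ← hP β γ b c]
  simp only [map_add, map_smul, LinearMap.add_apply, LinearMap.smul_apply, smul_add,
    hab, hac, hbc, ha, hb, hc, habc, mul_assoc]
  abel

end General

namespace PlanarTree

section Join

variable {X : Type u} {Ω : Type v}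

/-- The tree whose root edges are those of `S` followed by those of `T`, the new angle between
them being decorated by `x`. In the free Rota-Baxter family algebra this is `S ⋄ x ⋄ T`. -/
def join (x : X) : PlanarTree X Ω → PlanarTree X Ω → PlanarTree X Ω
  | single e, T => cons e x T
  | cons e y R, T => cons e y (join x R T)

theorem first_join (x : X) (S T : PlanarTree X Ω) : (join x S T).first = S.first := by
  cases S <;> rfl

theorem last_join (x : X) : ∀ S T : PlanarTree X Ω, (join x S T).last = T.last
  | single _, _ => rfl
  | cons _ _ R, T => last_join x R T

theorem setFirst_join (x : X) (e : Branch Ω (PlanarTree X Ω)) (S T : PlanarTree X Ω) :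
    (join x S T).setFirst e = join x (S.setFirst e) T := by
  cases S <;> rfl

theorem splice_join_left (x : X) (e : Branch Ω (PlanarTree X Ω)) :
    ∀ S T U : PlanarTree X Ω, splice e (join x S T) U = join x S (splice e T U)
  | single _, _, _ => rfl
  | cons a y R, T, U => congrArg (cons a y) (splice_join_left x e R T U)

theorem splice_join_right (x : X) (e : Branch Ω (PlanarTree X Ω)) :
    ∀ S T U : PlanarTree X Ω, splice e S (join x T U) = join x (splice e S T) U
  | single _, T, U => setFirst_join x e T U
  | cons a y R, T, U => congrArg (cons a y) (splice_join_right x e R T U)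

theorem setFirst_first (T : PlanarTree X Ω) : T.setFirst T.first = T := by
  cases T <;> rfl

theorem splice_last_unit : ∀ S : PlanarTree X Ω, splice S.last S unit = S
  | single _ => rfl
  | cons a x R => congrArg (cons a x) (splice_last_unit R)

@[elab_as_elim]
theorem join_induction {p : PlanarTree X Ω → Prop} (unit : p unit)
    (graft : ∀ ω T, p T → p (graft ω T)) (join : ∀ x S T, p S → p T → p (join x S T)) :
    ∀ T, p T
  | single .leaf => unit
  | single (.edge ω T) => graft ω T (join_induction unit graft join T)
  | cons .leaf x R => join x (single .leaf) R unit (join_induction unit graft join R)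
  | cons (.edge ω T) x R =>
    join x (single (.edge ω T)) R (graft ω T (join_induction unit graft join T))
      (join_induction unit graft join R)

end Join

section Product

variable {X : Type u} {Ω : Type v} {k : Type w} [CommRing k]

/-- The bilinear extension of `join`. -/
noncomputable def joinL (k : Type w) [CommRing k] (x : X) :
    (PlanarTree X Ω →₀ k) →ₗ[k] (PlanarTree X Ω →₀ k) →ₗ[k] (PlanarTree X Ω →₀ k) :=
  Finsupp.lift _ k _ fun S => Finsupp.lmapDomain k k (join x S)

theorem joinL_single_left (x : X) (S : PlanarTree X Ω) (a : PlanarTree X Ω →₀ k) :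
    joinL k x (Finsupp.single S 1) a = Finsupp.mapDomain (join x S) a := by
  simp [joinL]

theorem joinL_single_right (x : X) (a : PlanarTree X Ω →₀ k) (T : PlanarTree X Ω) :
    joinL k x a (Finsupp.single T 1) = Finsupp.mapDomain (fun S => join x S T) a := by
  have hmaps : (joinL k x).flip (Finsupp.single T 1) =
      Finsupp.lmapDomain k k (fun S : PlanarTree X Ω => join x S T) :=
    Finsupp.basisSingleOne.ext fun S => by simp [joinL, Finsupp.mapDomain_single]
  exact LinearMap.congr_fun hmaps a

theorem single_join (x : X) (S T : PlanarTree X Ω) :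
    Finsupp.single (join x S T) (1 : k) = joinL k x (Finsupp.single S 1) (Finsupp.single T 1) := by
  rw [joinL_single_left, Finsupp.mapDomain_single]

theorem single_graft (ω : Ω) (T : PlanarTree X Ω) :
    Finsupp.single (graft ω T) (1 : k) = graftL k ω (Finsupp.single T 1) := by
  simp [graftL, Finsupp.mapDomain_single]

variable [Semigroup Ω] (lam : k)

theorem diamond_single (S T : PlanarTree X Ω) :
    diamond lam (Finsupp.single S 1) (Finsupp.single T 1) = mul lam S T := by
  simp [diamond]

/-- The linear combination of edges by which the product of two trees replaces the last root edge
of the left factor and the first root edge of the right factor. -/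
noncomputable def branchMul :
    Branch Ω (PlanarTree X Ω) → Branch Ω (PlanarTree X Ω) → (Branch Ω (PlanarTree X Ω) →₀ k)
  | .leaf, e => Finsupp.single e 1
  | .edge α S, .leaf => Finsupp.single (.edge α S) 1
  | .edge α S, .edge β T => Finsupp.mapDomain (Branch.edge (α * β))
      (mul lam (graft α S) T + mul lam S (graft β T) + lam • mul lam S T)

theorem branchMul_leaf_right (e : Branch Ω (PlanarTree X Ω)) :
    branchMul lam e .leaf = Finsupp.single e 1 := by
  cases e <;> rfl

theorem mul_eq_mapDomain_branchMul (S T : PlanarTree X Ω) :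
    mul lam S T = Finsupp.mapDomain (fun e => splice e S T) (branchMul lam S.last T.first) := by
  rw [mul]
  split
  next hS => rw [hS, branchMul, Finsupp.mapDomain_single]
  next hS hT => rw [hS, hT, branchMul, Finsupp.mapDomain_single]
  next hS hT =>
    rw [hS, hT, branchMul, ← Finsupp.mapDomain_comp]
    rfl

theorem mul_join_left (x : X) (S T U : PlanarTree X Ω) :
    mul lam (join x S T) U = Finsupp.mapDomain (join x S) (mul lam T U) := by
  simp only [mul_eq_mapDomain_branchMul, ← Finsupp.mapDomain_comp, Function.comp_def, last_join,
    splice_join_left]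

theorem mul_join_right (x : X) (S T U : PlanarTree X Ω) :
    mul lam S (join x T U) = Finsupp.mapDomain (fun V => join x V U) (mul lam S T) := by
  simp only [mul_eq_mapDomain_branchMul, ← Finsupp.mapDomain_comp, Function.comp_def, first_join,
    splice_join_right]

theorem unit_mul (T : PlanarTree X Ω) : mul lam unit T = Finsupp.single T 1 := by
  rw [mul_eq_mapDomain_branchMul, unit, last, branchMul, Finsupp.mapDomain_single, splice,
    setFirst_first]

theorem mul_unit (S : PlanarTree X Ω) : mul lam S unit = Finsupp.single S 1 := by
  rw [mul_eq_mapDomain_branchMul, show (unit : PlanarTree X Ω).first = .leaf from rfl,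
    branchMul_leaf_right, Finsupp.mapDomain_single, splice_last_unit]

theorem mul_graft_graft (α β : Ω) (S T : PlanarTree X Ω) :
    mul lam (graft α S) (graft β T) = graftL k (α * β)
      (mul lam (graft α S) T + mul lam S (graft β T) + lam • mul lam S T) := by
  rw [mul_eq_mapDomain_branchMul]
  exact Finsupp.mapDomain_comp.symm

theorem diamond_joinL_left (x : X) (a b c : PlanarTree X Ω →₀ k) :
    diamond lam (joinL k x a b) c = joinL k x a (diamond lam b c) := by
  refine bilin_assoc_of_single (fun S T U => ?_) a b c
  rw [← single_join, diamond_single, mul_join_left, diamond_single, joinL_single_left]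

theorem diamond_joinL_right (x : X) (a b c : PlanarTree X Ω →₀ k) :
    diamond lam a (joinL k x b c) = joinL k x (diamond lam a b) c := by
  refine (bilin_assoc_of_single (fun S T U => ?_) a b c).symm
  rw [← single_join, diamond_single lam S T, diamond_single, mul_join_right, joinL_single_right]

theorem unit_diamond (a : PlanarTree X Ω →₀ k) :
    diamond lam (Finsupp.single unit 1) a = a := by
  have hmaps : diamond lam (Finsupp.single (unit : PlanarTree X Ω) 1) = LinearMap.id :=
    Finsupp.basisSingleOne.ext fun T => by simp [diamond_single, unit_mul]
  exact LinearMap.congr_fun hmaps a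

theorem diamond_unit (a : PlanarTree X Ω →₀ k) :
    diamond lam a (Finsupp.single unit 1) = a := by
  have hmaps : (diamond lam).flip (Finsupp.single (unit : PlanarTree X Ω) 1) = LinearMap.id :=
    Finsupp.basisSingleOne.ext fun S => by simp [diamond_single, mul_unit]
  exact LinearMap.congr_fun hmaps a

theorem diamond_graftL_graftL (α β : Ω) (a b : PlanarTree X Ω →₀ k) :
    diamond lam (graftL k α a) (graftL k β b) = graftL k (α * β)
      (diamond lam (graftL k α a) b + diamond lam a (graftL k β b) + lam • diamond lam a b) := by
  refine bilin_eq_of_single (m := (diamond lam).compl₁₂ (graftL k α) (graftL k β))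
    (m' := LinearMap.compr₂ (diamond lam ∘ₗ graftL k α + (diamond lam).compl₂ (graftL k β) +
      lam • diamond lam) (graftL k (α * β))) (fun S T => ?_) a b
  simp only [LinearMap.add_apply, LinearMap.smul_apply, LinearMap.comp_apply,
    LinearMap.compl₂_apply, LinearMap.compl₁₂_apply, LinearMap.compr₂_apply, ← single_graft,
    diamond_single, mul_graft_graft]

theorem diamond_assoc_single (S T U : PlanarTree X Ω) :
    diamond lam (diamond lam (Finsupp.single S 1) (Finsupp.single T 1)) (Finsupp.single U 1) =
      diamond lam (Finsupp.single S (1 : k))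
        (diamond lam (Finsupp.single T 1) (Finsupp.single U 1)) := by
  induction S using join_induction generalizing T U with
  | unit => simp only [unit_diamond]
  | join x S₁ S₂ _ ih => simp only [single_join, diamond_joinL_left, ih]
  | graft α S ihS =>
    induction T using join_induction generalizing U with
    | unit => simp only [unit_diamond, diamond_unit]
    | join x T₁ T₂ _ _ => simp only [single_join, diamond_joinL_left, diamond_joinL_right]
    | graft β T ihT =>
      induction U using join_induction with
      | unit => simp only [diamond_unit]
      | join x U₁ U₂ ih _ => simp only [single_join, diamond_joinL_right, ih]
      | graft γ U ihU =>
        simp only [single_graft] at ihT ihU ⊢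
        exact assoc_of_rotaBaxter (diamond_graftL_graftL lam) ihU
          (by simpa only [single_graft] using ihT (graft γ U))
          (by simpa only [single_graft] using ihS (graft β T) (graft γ U))
          (ihT U)
          (by simpa only [single_graft] using ihS (graft β T) U)
          (by simpa only [single_graft] using ihS T (graft γ U))
          (ihS T U)

theorem diamond_assoc (a b c : PlanarTree X Ω →₀ k) :
    diamond lam (diamond lam a b) c = diamond lam a (diamond lam b c) :=
  bilin_assoc_of_single (diamond_assoc_single lam) a b c

theorem isRotaBaxterFamilyAlgebra :
    IsRotaBaxterFamilyAlgebra lam (diamond (X := X) (Ω := Ω) lam)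
      (Finsupp.single unit 1) (graftL k) where
  mul_assoc := diamond_assoc lam
  one_mul := unit_diamond lam
  mul_one := diamond_unit lam
  rota_baxter := diamond_graftL_graftL lam

theorem joinL_eq_diamond_corolla (x : X) (a b : PlanarTree X Ω →₀ k) :
    joinL k x a b = diamond lam a (diamond lam (Finsupp.single (corolla x) 1) b) := by
  have hcorolla : Finsupp.single (corolla x : PlanarTree X Ω) (1 : k) =
      joinL k x (Finsupp.single unit 1) (Finsupp.single unit 1) :=
    single_join x unit unit
  rw [hcorolla, diamond_joinL_left, unit_diamond, diamond_joinL_right, diamond_unit]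

end Product

section Universal

variable {X : Type u} {Ω : Type v} {k : Type w} [CommRing k]
  {A : Type z} [Ring A] [Algebra k A] (P : Ω → A →ₗ[k] A) (f : X → A)

/-- The value of a tree in an algebra `A` with operators `P`, for the interpretation `f` of the
angle decorations: the ordered product of the values of the root edges and angles, where a leaf has
the value `1` and an edge of type `ω` applies `P ω` to the value of the tree grafted on it. -/
def eval : PlanarTree X Ω → A
  | single .leaf => 1
  | single (.edge ω T) => P ω (eval T)
  | cons .leaf x R => f x * eval R
  | cons (.edge ω T) x R => P ω (eval T) * f x * eval R

theorem eval_unit : eval P f unit = 1 := by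
  rw [unit, eval]

theorem eval_graft (ω : Ω) (T : PlanarTree X Ω) : eval P f (graft ω T) = P ω (eval P f T) := by
  rw [graft, eval]

theorem eval_corolla (x : X) : eval P f (corolla x) = f x := by
  rw [corolla, eval, eval, mul_one]

theorem eval_cons (e : Branch Ω (PlanarTree X Ω)) (x : X) (R : PlanarTree X Ω) :
    eval P f (cons e x R) = eval P f (single e) * f x * eval P f R := by
  cases e <;> simp only [eval, one_mul]

theorem eval_join (x : X) : ∀ S T : PlanarTree X Ω,
    eval P f (join x S T) = eval P f S * f x * eval P f T
  | single e, T => eval_cons P f e x T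
  | cons e y R, T => by
    rw [join, eval_cons, eval_cons, eval_join x R T]
    simp only [mul_assoc]

/-- The linear extension of `eval`: the morphism out of the free Rota-Baxter family algebra that
extends `f`. -/
noncomputable def evalL : (PlanarTree X Ω →₀ k) →ₗ[k] A :=
  Finsupp.lift A k _ (eval P f)

theorem evalL_single (T : PlanarTree X Ω) : evalL P f (Finsupp.single T 1) = eval P f T := by
  simp [evalL]

theorem evalL_graftL (ω : Ω) (a : PlanarTree X Ω →₀ k) :
    evalL P f (graftL k ω a) = P ω (evalL P f a) := by
  have hmaps : evalL P f ∘ₗ graftL k ω = P ω ∘ₗ evalL P f :=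
    Finsupp.basisSingleOne.ext fun T => by
      simp [← single_graft, evalL_single, eval_graft]
  exact LinearMap.congr_fun hmaps a

theorem evalL_joinL (x : X) (a b : PlanarTree X Ω →₀ k) :
    evalL P f (joinL k x a b) = evalL P f a * f x * evalL P f b := by
  refine bilin_eq_of_single (m := (joinL k x).compr₂ (evalL P f))
    (m' := (LinearMap.mul k A).compl₁₂ (LinearMap.mulRight k (f x) ∘ₗ evalL P f) (evalL P f))
    (fun S T => ?_) a b
  simp [← single_join, evalL_single, eval_join]

variable [Semigroup Ω] {lam : k}

theorem eq_evalL {φ : (PlanarTree X Ω →₀ k) →ₗ[k] A}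
    (hone : φ (Finsupp.single unit 1) = 1)
    (hmul : ∀ a b, φ (diamond lam a b) = φ a * φ b)
    (hgraft : ∀ ω a, φ (graftL k ω a) = P ω (φ a))
    (hcorolla : ∀ x, φ (Finsupp.single (corolla x) 1) = f x) : φ = evalL P f := by
  refine Finsupp.basisSingleOne.ext fun T => ?_
  simp only [Finsupp.coe_basisSingleOne]
  induction T using join_induction with
  | unit => rw [hone, evalL_single, eval_unit]
  | graft ω T ih => rw [single_graft, hgraft, ih, evalL_graftL]
  | join x S T ihS ihT =>
    rw [single_join, evalL_joinL, joinL_eq_diamond_corolla lam, hmul, hmul, hcorolla, ihS, ihT,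
      mul_assoc]

variable (hP : ∀ α β a b, P α a * P β b = P (α * β) (P α a * b + a * P β b + lam • (a * b)))
include hP

theorem evalL_diamond_single (S T : PlanarTree X Ω) :
    evalL P f (diamond lam (Finsupp.single S 1) (Finsupp.single T 1)) =
      evalL P f (Finsupp.single S 1) * evalL P f (Finsupp.single T 1) := by
  induction S using join_induction generalizing T with
  | unit => rw [unit_diamond, evalL_single _ _ unit, eval_unit, one_mul]
  | join x S₁ S₂ _ ih =>
    simp only [single_join, diamond_joinL_left, evalL_joinL, ih, mul_assoc]
  | graft α S ihS =>
    induction T using join_induction with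
    | unit => rw [diamond_unit, evalL_single _ _ unit, eval_unit, mul_one]
    | join x T₁ T₂ ih _ =>
      simp only [single_join, diamond_joinL_right, evalL_joinL, ih, mul_assoc]
    | graft β T ihT =>
      have ihS_graft := ihS (graft β T)
      simp only [single_graft] at ihT ihS_graft ⊢
      simp only [diamond_graftL_graftL, evalL_graftL, map_add, map_smul, ihS T, ihT, ihS_graft, hP]

theorem evalL_diamond (a b : PlanarTree X Ω →₀ k) :
    evalL P f (diamond lam a b) = evalL P f a * evalL P f b :=
  bilin_eq_of_single (m := (diamond lam).compr₂ (evalL P f))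
    (m' := (LinearMap.mul k A).compl₁₂ (evalL P f) (evalL P f)) (evalL_diamond_single P f hP) a b

end Universal

end PlanarTree

/-- The free module on `X`-angularly decorated `Ω`-typed planar rooted trees, with the product `⋄`
of weight `lam` and the grafting operators, is the free Rota-Baxter family algebra of weight `lam`
on `X`. -/
theorem theorem2p6 {k : Type w} [CommRing k] (X : Type u) (Ω : Type v) [Semigroup Ω] (lam : k) :
    IsRotaBaxterFamilyAlgebra lam (PlanarTree.diamond (X := X) (Ω := Ω) lam)
      (Finsupp.single PlanarTree.unit 1) (PlanarTree.graftL k) ∧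
    ∀ (A : Type z) [Ring A] [Algebra k A] (P : Ω → A →ₗ[k] A),
      IsRotaBaxterFamilyAlgebra lam (LinearMap.mul k A) 1 P →
      ∀ f : X → A, ∃! φ : (PlanarTree X Ω →₀ k) →ₗ[k] A,
        φ (Finsupp.single PlanarTree.unit 1) = 1 ∧
        (∀ a b, φ (PlanarTree.diamond lam a b) = φ a * φ b) ∧
        (∀ ω a, φ (PlanarTree.graftL k ω a) = P ω (φ a)) ∧
        ∀ x, φ (Finsupp.single (PlanarTree.corolla x) 1) = f x := by
  refine ⟨PlanarTree.isRotaBaxterFamilyAlgebra lam, fun A _ _ P hA f => ?_⟩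
  have hP : ∀ α β a b, P α a * P β b = P (α * β) (P α a * b + a * P β b + lam • (a * b)) :=
    hA.rota_baxter
  refine ⟨PlanarTree.evalL P f, ⟨?_, PlanarTree.evalL_diamond P f hP,
    PlanarTree.evalL_graftL P f, fun x => ?_⟩, ?_⟩
  · rw [PlanarTree.evalL_single, PlanarTree.eval_unit]
  · rw [PlanarTree.evalL_single, PlanarTree.eval_corolla]
  · rintro φ ⟨hone, hmul, hgraft, hcorolla⟩
    exact PlanarTree.eq_evalL P f hone hmul hgraft hcorolla
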